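/- Let $\mathfrak H$ be a complex Hilbert space. A positive, symmetric operator $a$ in $\mathfrak H$ is a linear map $a:\mathrm{dom}\,a\to\mathfrak H$ on a (not necessarily dense) linear subspace such that $(ax,y)=(x,ay)$ and $(ax,x)\ge 0$ for all $x,y\in\mathrm{dom}\,a$. Its form domain is $$\mathrm{fdom}\,a=\{y\in\mathfrak H:\ \exists\, m_y\ \ |(ax,y)|^2\le m_y\,(ax,x)\ \text{ for all } x\in\mathrm{dom}\,a\}.$$ If $\mathrm{fdom}\,a$ is dense, then $\langle ax,ay\rangle=(ax,y)$ is an inner product on $\mathrm{ran}\,a$; let $\mathfrak H_a$ be the completion of $\mathrm{ran}\,a$ with respect to it, and let $J_a:\mathfrak H_a\to\mathfrak H$ be the operator with $\mathrm{dom}\,J_a=\mathrm{ran}\,a$ and $J_a(ax)=ax$. Put $a_{\mathsf K}=J_a^{**}J_a^{*}$. Let $a,b$ be positive, symmetric operators in $\mathfrak H$ such that $\mathrm{fdom}\,a\cap\mathrm{fdom}\,b$ is dense in $\mathfrak H$. Define $J:\mathfrak H_a\oplus\mathfrak H_b\to\mathfrak H$ by $\mathrm{dom}\,J=\mathrm{ran}\,a\oplus\mathrm{ran}\,b$,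 $J(ax\oplus by)=ax+by$, and set $a\dotplus b:=J^{**}J^{*}$. Then: 1. $a_{\mathsf K}$ is the Krein–von Neumann extension of $a$, that is, the unique smallest positive selfadjoint extension of $a$, and likewise $b_{\mathsf K}$ for $b$. Here, for positive selfadjoint operators, $A\le B$ means that $\mathrm{dom}\,B^{1/2}\subseteq\mathrm{dom}\,A^{1/2}$ and $\|A^{1/2}x\|\le\|B^{1/2}x\|$ for all $x\in\mathrm{dom}\,B^{1/2}$. 2. $\mathrm{fdom}\,a_{\mathsf K}\cap\mathrm{fdom}\,b_{\mathsf K}$ is dense, so that $a_{\mathsf K}\dotplus b_{\mathsf K}$ is defined by the same construction, and $$a\dotplus b=a_{\mathsf K}\dotplus b_{\mathsf K}.$$ 3. This operator is also the classical form sum of the selfadjoint operators $a_{\mathsf K}$ and $b_{\mathsf K}$: it is the positive selfadjoint operator $C$ with $\mathrm{dom}\,C^{1/2}=\mathrm{dom}\,a_{\mathsf K}^{1/2}\cap\mathrm{dom}\,b_{\mathsf K}^{1/2}$ and $\|C^{1/2}x\|^2=\|a_{\mathsf K}^{1/2}x\|^2+\|b_{\mathsf K}^{1/2}x\|^2$ for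 all $x$ in this domain. -/

import Mathlib

/-! Unbounded operators are `LinearPMap`s. Mathlib's inner product `inner ℂ x y` is linear in the
second variable. -/

open scoped LinearPMap

noncomputable section

variable {H K L : Type*} [NormedAddCommGroup H] [InnerProductSpace ℂ H]
  [NormedAddCommGroup K] [InnerProductSpace ℂ K] [NormedAddCommGroup L] [InnerProductSpace ℂ L]

/-- The composition `S ∘ T` of unbounded operators on its natural domain
`{x ∈ dom T | T x ∈ dom S}`. -/
def opComp (S : K →ₗ.[ℂ] L) (T : H →ₗ.[ℂ] K) : H →ₗ.[ℂ] L :=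
  S.comp (T.domRestrict ((S.domain.comap T.toFun).map T.domain.subtype)) (by
    rintro ⟨x, ⟨⟨y, hy, rfl⟩, hx⟩⟩
    exact hy)

theorem mem_opComp_domain {S : K →ₗ.[ℂ] L} {T : H →ₗ.[ℂ] K} {x : H} :
    x ∈ (opComp S T).domain ↔ ∃ hx : x ∈ T.domain, T ⟨x, hx⟩ ∈ S.domain := by
  constructor
  · rintro ⟨⟨y, hy, rfl⟩, hx⟩
    exact ⟨hx, hy⟩
  · rintro ⟨hx, h⟩
    exact ⟨⟨⟨x, hx⟩, h, rfl⟩, hx⟩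

theorem opComp_apply {S : K →ₗ.[ℂ] L} {T : H →ₗ.[ℂ] K} {x : H} (h : x ∈ (opComp S T).domain)
    (hx : x ∈ T.domain) (hy : T ⟨x, hx⟩ ∈ S.domain) :
    opComp S T ⟨x, h⟩ = S ⟨T ⟨x, hx⟩, hy⟩ := rfl

/-- A positive operator: `(A x, x) ≥ 0` for all `x ∈ dom A`. -/
def OpNonneg (A : H →ₗ.[ℂ] H) : Prop :=
  ∀ x : A.domain, 0 ≤ (inner ℂ (A x) (x : H)).re

/-- A positive, symmetric operator in `H`; its domain is an arbitrary linear subspace, not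
necessarily dense. -/
@[ext]
structure PosSymOp (H : Type*) [NormedAddCommGroup H] [InnerProductSpace ℂ H] where
  op : H →ₗ.[ℂ] H
  symmetric : ∀ x y : op.domain, inner ℂ (op x) (y : H) = inner ℂ (x : H) (op y)
  nonneg : OpNonneg op

/-! ### Selfadjoint operators: square root, form order, classical form sum -/

section SelfAdjoint

variable [CompleteSpace H]

/-- A positive, selfadjoint (in particular densely defined) operator. -/
def IsPosSelfAdjoint (A : H →ₗ.[ℂ] H) : Prop :=
  IsSelfAdjoint A ∧ OpNonneg A

/-- `S` is a positive, selfadjoint square root of `A`. -/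
def IsPosSqrt (S A : H →ₗ.[ℂ] H) : Prop :=
  IsPosSelfAdjoint S ∧ opComp S S = A

open scoped Classical in
/-- The positive, selfadjoint square root of a positive, selfadjoint operator
(the zero operator where there is no square root). -/
def posSqrt (A : H →ₗ.[ℂ] H) : H →ₗ.[ℂ] H :=
  if h : ∃ S, IsPosSqrt S A then h.choose else 0

/-- The form order `A ≤ B` of positive, selfadjoint operators: `dom B^{1/2} ⊆ dom A^{1/2}` and
`‖A^{1/2} x‖ ≤ ‖B^{1/2} x‖` for `x ∈ dom B^{1/2}`. -/
def FormLE (A B : H →ₗ.[ℂ] H) : Prop :=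
  ∀ x (hB : x ∈ (posSqrt B).domain), ∃ hA : x ∈ (posSqrt A).domain,
    ‖posSqrt A ⟨x, hA⟩‖ ≤ ‖posSqrt B ⟨x, hB⟩‖

/-- `A` is the Krein-von Neumann extension of `a`: the smallest, in the form order, of the
positive, selfadjoint extensions of `a`. -/
def IsKreinVonNeumann (a A : H →ₗ.[ℂ] H) : Prop :=
  (IsPosSelfAdjoint A ∧ a ≤ A) ∧ ∀ B, IsPosSelfAdjoint B → a ≤ B → FormLE A B

/-- `C` is the (classical) form sum of the positive, selfadjoint operators `A` and `B`: the
positive, selfadjoint operator representing the closed form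
`x ↦ ‖A^{1/2} x‖² + ‖B^{1/2} x‖²` on `dom A^{1/2} ∩ dom B^{1/2}`. -/
def IsClassicalFormSum (A B C : H →ₗ.[ℂ] H) : Prop :=
  IsPosSelfAdjoint C ∧
  (posSqrt C).domain = (posSqrt A).domain ⊓ (posSqrt B).domain ∧
  ∀ x (hC : x ∈ (posSqrt C).domain) (hA : x ∈ (posSqrt A).domain) (hB : x ∈ (posSqrt B).domain),
    ‖posSqrt C ⟨x, hC⟩‖ ^ 2 = ‖posSqrt A ⟨x, hA⟩‖ ^ 2 + ‖posSqrt B ⟨x, hB⟩‖ ^ 2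

/-- `T** T*` is positive and symmetric. -/
def adjAdjComp [CompleteSpace K] (T : K →ₗ.[ℂ] H) : PosSymOp H where
  op := opComp T†† T†
  symmetric := by
    rintro ⟨x, hx⟩ ⟨y, hy⟩
    obtain ⟨hx1, hx2⟩ := mem_opComp_domain.1 hx
    obtain ⟨hy1, hy2⟩ := mem_opComp_domain.1 hy
    rw [opComp_apply hx hx1 hx2, opComp_apply hy hy1 hy2]
    by_cases hd : Dense (T†.domain : Set H)
    · rw [LinearPMap.adjoint_isFormalAdjoint hd ⟨_, hx2⟩ ⟨y, hy1⟩,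
        ← (LinearPMap.adjoint_isFormalAdjoint hd).symm ⟨x, hx1⟩ ⟨_, hy2⟩]
    · simp [LinearPMap.adjoint_apply_of_not_dense hd]
  nonneg := by
    rintro ⟨x, hx⟩
    obtain ⟨hx1, hx2⟩ := mem_opComp_domain.1 hx
    rw [opComp_apply hx hx1 hx2]
    by_cases hd : Dense (T†.domain : Set H)
    · rw [LinearPMap.adjoint_isFormalAdjoint hd ⟨_, hx2⟩ ⟨x, hx1⟩]
      exact inner_self_nonneg (𝕜 := ℂ)
    · simp [LinearPMap.adjoint_apply_of_not_dense hd]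

end SelfAdjoint

namespace PosSymOp

/-- The form domain of `a`. -/
def fdom (a : PosSymOp H) : Set H :=
  {y | ∃ m : ℝ, ∀ x : a.op.domain,
    ‖inner ℂ (a.op x) y‖ ^ 2 ≤ m * (inner ℂ (a.op x) (x : H)).re}

/-! ### The space `H_a`: completion of `ran a` for the inner product `⟨a x, a y⟩ = (a x, y)` -/

/-- The range of `a`, as a type of its own since it will carry a new inner product. -/
def Ran (a : PosSymOp H) : Type _ := LinearMap.range a.op.toFun

instance (a : PosSymOp H) : AddCommGroup a.Ran :=
  inferInstanceAs (AddCommGroup (LinearMap.range a.op.toFun))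

instance (a : PosSymOp H) : Module ℂ a.Ran :=
  inferInstanceAs (Module ℂ (LinearMap.range a.op.toFun))

/-- The inclusion of `ran a` in `H`. -/
def ranIncl (a : PosSymOp H) : a.Ran →ₗ[ℂ] H := (LinearMap.range a.op.toFun).subtype

/-- `a x` as an element of `ran a`. -/
def toRan (a : PosSymOp H) (x : a.op.domain) : a.Ran := ⟨a.op x, x, rfl⟩

/-- Some `x ∈ dom a` with `a x = u`. -/
def preimg (a : PosSymOp H) (u : a.Ran) : a.op.domain := u.2.choose

theorem op_preimg (a : PosSymOp H) (u : a.Ran) : a.op (a.preimg u) = a.ranIncl u :=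
  u.2.choose_spec

theorem inner_preimg (a : PosSymOp H) (u v : a.Ran) :
    inner ℂ (a.ranIncl u) (a.preimg v : H) = inner ℂ (a.preimg u : H) (a.ranIncl v) := by
  rw [← op_preimg, ← op_preimg, a.symmetric]

/-- The form `⟨a x, a y⟩ = (a x, y)` on `ran a` is well defined and nonnegative. -/
instance ranCore (a : PosSymOp H) : PreInnerProductSpace.Core ℂ a.Ran where
  inner u v := inner ℂ (a.ranIncl u) (a.preimg v : H)
  conj_inner_symm u v := by
    rw [inner_conj_symm, inner_preimg]
  re_inner_nonneg u := by
    have := a.nonneg (a.preimg u)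
    rwa [op_preimg] at this
  add_left u v w := by
    rw [map_add, inner_add_left]
  smul_left u v r := by
    rw [map_smul, inner_smul_left]

instance (a : PosSymOp H) : SeminormedAddCommGroup a.Ran :=
  InnerProductSpace.Core.toSeminormedAddCommGroup (𝕜 := ℂ)

instance (a : PosSymOp H) : InnerProductSpace ℂ a.Ran :=
  InnerProductSpace.ofCore a.ranCore

theorem inner_toRan (a : PosSymOp H) (x y : a.op.domain) :
    inner ℂ (a.toRan x) (a.toRan y) = inner ℂ (a.op x) (y : H) := by
  change inner ℂ (a.op x) (a.preimg (a.toRan y) : H) = _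
  rw [a.symmetric, op_preimg, a.symmetric]
  rfl

/-- The Hilbert space `H_a`. -/
abbrev Hil (a : PosSymOp H) : Type _ := UniformSpace.Completion a.Ran

/-- The canonical map `ran a → H_a`. -/
def ranToHil (a : PosSymOp H) : a.Ran →ₗ[ℂ] a.Hil :=
  (UniformSpace.Completion.toComplL (𝕜 := ℂ) (E := a.Ran)).toLinearMap

/-- If the form domain is dense then `⟨·, ·⟩` is definite on `ran a`, so that `ran a` is a subspace
of `H_a`. -/
theorem ranToHil_injective (a : PosSymOp H) (ha : Dense a.fdom) :
    Function.Injective a.ranToHil := by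
  rw [injective_iff_map_eq_zero]
  intro u hu
  have h0 : inner ℂ u u = (0 : ℂ) := by
    have : inner ℂ (a.ranToHil u) (a.ranToHil u) = (0 : ℂ) := by rw [hu, inner_zero_left]
    rwa [← UniformSpace.Completion.inner_coe (𝕜 := ℂ) u u]
  have h1 : inner ℂ (a.op (a.preimg u)) (a.preimg u : H) = (0 : ℂ) := by
    rw [op_preimg]; exact h0
  have h2 : a.ranIncl u = 0 := by
    refine ha.eq_zero_of_inner_left ℂ fun y hy => ?_
    obtain ⟨m, hm⟩ := hy
    have := hm (a.preimg u)
    rw [h1, op_preimg, Complex.zero_re, mul_zero] at this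
    exact norm_eq_zero.1 (pow_eq_zero_iff (two_ne_zero) |>.1 (le_antisymm this (sq_nonneg _)))
  exact Subtype.ext h2

/-! ### The operators `J_a` and `J`, the Krein-von Neumann extension and the form sum -/

/-- `J_a : H_a → H`, `dom J_a = ran a`, `J_a (a x) = a x`, given by its graph (which is single valued
if the form domain of `a` is dense). -/
def J₁ (a : PosSymOp H) : a.Hil →ₗ.[ℂ] H :=
  (LinearMap.range (a.ranToHil.prod a.ranIncl)).toLinearPMap

/-- `J : H_a ⊕ H_b → H`, `dom J = ran a ⊕ ran b`, `J (a x ⊕ b y) = a x + b y`, given by its graph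
(which is single valued if the form domains of `a` and `b` are dense). -/
def J₂ (a b : PosSymOp H) : WithLp 2 (a.Hil × b.Hil) →ₗ.[ℂ] H :=
  (LinearMap.range
    (((WithLp.linearEquiv 2 ℂ (a.Hil × b.Hil)).symm.toLinearMap ∘ₗ
      a.ranToHil.prodMap b.ranToHil).prod (a.ranIncl.coprod b.ranIncl))).toLinearPMap

theorem J₁_graph (a : PosSymOp H) (ha : Dense a.fdom) (x : a.Hil) (z : H) :
    (x, z) ∈ a.J₁.graph ↔ ∃ u : a.Ran, a.ranToHil u = x ∧ a.ranIncl u = z := by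
  unfold J₁
  rw [Submodule.toLinearPMap_graph_eq]
  · simp [LinearMap.mem_range]
  · rintro _ ⟨u, rfl⟩ h
    replace h : a.ranToHil u = 0 := h
    rw [(injective_iff_map_eq_zero _).1 (a.ranToHil_injective ha) u h]
    simp

theorem J₂_graph (a b : PosSymOp H) (ha : Dense a.fdom) (hb : Dense b.fdom)
    (x : a.Hil) (y : b.Hil) (z : H) :
    (WithLp.toLp 2 (x, y), z) ∈ (J₂ a b).graph ↔
      ∃ (u : a.Ran) (v : b.Ran), a.ranToHil u = x ∧ b.ranToHil v = y ∧
        a.ranIncl u + b.ranIncl v = z := by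
  unfold J₂
  rw [Submodule.toLinearPMap_graph_eq]
  · simp [LinearMap.mem_range, and_assoc]
  · rintro _ ⟨⟨u, v⟩, rfl⟩ h
    have h' : a.ranToHil u = 0 ∧ b.ranToHil v = 0 := by simpa using h
    rw [(injective_iff_map_eq_zero _).1 (a.ranToHil_injective ha) u h'.1,
      (injective_iff_map_eq_zero _).1 (b.ranToHil_injective hb) v h'.2]
    simp

/-- `a_K = J_a** J_a*`. -/
def krein [CompleteSpace H] (a : PosSymOp H) : PosSymOp H := adjAdjComp a.J₁

/-- The form sum `J** J*` of two positive, symmetric operators. -/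
def formSum [CompleteSpace H] (a b : PosSymOp H) : PosSymOp H := adjAdjComp (J₂ a b)

end PosSymOp

end

/-! ### Graphs of unbounded operators: adjoints, `T* T`, resolvents and square roots. -/

section Graph

variable {H K L : Type*} [NormedAddCommGroup H] [InnerProductSpace ℂ H]
  [NormedAddCommGroup K] [InnerProductSpace ℂ K] [NormedAddCommGroup L] [InnerProductSpace ℂ L]

/-! Everything is read off from quadratic forms. Call `m` a bound at `x` if `|(ay, x)|² ≤ m (ay, y)`
for all `y` in `dom a`. By Riesz, a bound exists exactly when `x` lies in `dom J_a*`, and the least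
nonnegative one is `‖J_a* x‖²` (`formRepresents_J₁_adjoint`). For closed, densely defined `T`, the
bounds of `T* T` are governed in the same way by `‖T x‖²` (`formRepresents_adjoint_comp_self`). With
`T = J_a*` this shows that `a` and `a_K` have the same form; with `T = A^{1/2}` it identifies that
form with the one defined by the square root.

Minimality follows because an extension of `a` has more test vectors `y`, hence a larger form. For
the sum, `J* x = J_a* x ⊕ J_b* x` (`mem_graph_J₂_adjoint_iff`), so the form of `a ∔ b` is the sum of
the forms of `a` and `b`, which do not change on passing to `a_K` and `b_K`. Finally `T* T` is
determined by its form (`adjoint_comp_self_congr`), which gives the equality of operators. -/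

theorem mem_graph_adjoint_iff [CompleteSpace H] {T : H →ₗ.[ℂ] K} (hT : Dense (T.domain : Set H))
    {x : K} {w : H} :
    (x, w) ∈ T†.graph ↔ ∀ v z, (v, z) ∈ T.graph → inner ℂ w v = inner ℂ x z := by
  constructor
  · intro h v z hv
    obtain ⟨y, rfl, rfl⟩ := (LinearPMap.mem_graph_iff _).1 h
    obtain ⟨v, rfl, rfl⟩ := (LinearPMap.mem_graph_iff _).1 hv
    exact LinearPMap.adjoint_isFormalAdjoint hT y v
  · intro h
    have h' : ∀ v : T.domain, inner ℂ w (v : H) = inner ℂ x (T v) :=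
      fun v => h _ _ (T.mem_graph v)
    have hx : x ∈ T†.domain := LinearPMap.mem_adjoint_domain_of_exists x ⟨w, h'⟩
    rw [LinearPMap.mem_graph_iff]
    exact ⟨⟨x, hx⟩, rfl, LinearPMap.adjoint_apply_eq hT ⟨x, hx⟩ h'⟩

theorem mem_graph_opComp_iff {S : K →ₗ.[ℂ] L} {T : H →ₗ.[ℂ] K} {x : H} {z : L} :
    (x, z) ∈ (opComp S T).graph ↔ ∃ y, (x, y) ∈ T.graph ∧ (y, z) ∈ S.graph := by
  constructor
  · intro h
    obtain ⟨⟨x, hx⟩, rfl, rfl⟩ := (LinearPMap.mem_graph_iff _).1 h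
    obtain ⟨h1, h2⟩ := mem_opComp_domain.1 hx
    exact ⟨T ⟨x, h1⟩, T.mem_graph ⟨x, h1⟩, S.mem_graph ⟨_, h2⟩⟩
  · rintro ⟨y, h1, h2⟩
    obtain ⟨⟨x, hx⟩, rfl, rfl⟩ := (LinearPMap.mem_graph_iff _).1 h1
    rw [LinearPMap.mem_graph_iff]
    exact ⟨⟨x, mem_opComp_domain.2 ⟨hx, LinearPMap.mem_domain_of_mem_graph h2⟩⟩, rfl,
      ((LinearPMap.image_iff _).2 h2).symm⟩

/-- The graph of a closed, densely defined operator and the rotated graph of its adjoint span the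
whole space. -/
theorem exists_graph_add_adjoint_graph [CompleteSpace H] [CompleteSpace K] {T : H →ₗ.[ℂ] K}
    (hT : Dense (T.domain : Set H)) (hc : T.IsClosed) (h : H) (k : K) :
    ∃ p p' q q', (p, p') ∈ T.graph ∧ (q, q') ∈ T†.graph ∧ h = p + q' ∧ k = p' - q := by
  -- The graph is moved to the Hilbert sum, where it has an orthogonal complement: `g'` is
  -- orthogonal to it exactly when `(-g'.snd, g'.fst)` lies in the graph of `T*`.
  let G : Submodule ℂ (WithLp 2 (H × K)) :=
    T.graph.comap (WithLp.linearEquiv 2 ℂ (H × K)).toLinearMap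
  have hG : IsClosed (G : Set (WithLp 2 (H × K))) :=
    IsClosed.preimage (WithLp.prod_continuous_ofLp 2 H K) hc
  have : CompleteSpace G := hG.completeSpace_coe
  obtain ⟨g, hg, g', hg', e⟩ := G.exists_add_mem_mem_orthogonal (WithLp.toLp 2 (h, k))
  refine ⟨g.fst, g.snd, -g'.snd, g'.fst, hg, ?_, ?_, ?_⟩
  · rw [mem_graph_adjoint_iff hT]
    intro v z hv
    have := (Submodule.mem_orthogonal' _ _).1 hg' (WithLp.toLp 2 (v, z)) hv
    rw [WithLp.prod_inner_apply] at this
    rw [inner_neg_left]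
    exact eq_neg_of_add_eq_zero_left this
  · simpa using congrArg (fun u => u.fst) e
  · simpa using congrArg (fun u => u.snd) e

theorem IsSelfAdjoint.inner_graph [CompleteSpace H] {A : H →ₗ.[ℂ] H} (hA : IsSelfAdjoint A)
    {x w y z : H} (hx : (x, w) ∈ A.graph) (hy : (y, z) ∈ A.graph) :
    inner ℂ w y = inner ℂ x z := by
  rw [← LinearPMap.isSelfAdjoint_def.1 hA] at hx
  exact (mem_graph_adjoint_iff hA.dense_domain).1 hx _ _ hy

theorem OpNonneg.inner_graph {A : H →ₗ.[ℂ] H} (hA : OpNonneg A)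
    {x w : H} (hx : (x, w) ∈ A.graph) : 0 ≤ (inner ℂ w x).re := by
  obtain ⟨x, rfl, rfl⟩ := (LinearPMap.mem_graph_iff _).1 hx
  exact hA x

/-- A positive, symmetric operator `A` with `1 + A` onto is selfadjoint. -/
theorem isPosSelfAdjoint_of_surjective [CompleteSpace H] {A : H →ₗ.[ℂ] H}
    (hs : ∀ x w y z, (x, w) ∈ A.graph → (y, z) ∈ A.graph → inner ℂ w y = inner ℂ x z)
    (hp : OpNonneg A) (h1 : ∀ h, ∃ x w, (x, w) ∈ A.graph ∧ x + w = h) : IsPosSelfAdjoint A := by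
  have hd : Dense (A.domain : Set H) := by
    rw [Submodule.dense_iff_topologicalClosure_eq_top,
      Submodule.topologicalClosure_eq_top_iff, Submodule.eq_bot_iff]
    intro z hz
    obtain ⟨x, w, hx, rfl⟩ := h1 z
    have h0 := (Submodule.mem_orthogonal' _ _).1 hz x (LinearPMap.mem_domain_of_mem_graph hx)
    rw [inner_add_left] at h0
    have h2 := congrArg Complex.re h0
    have h3 := hp.inner_graph hx
    have h4 : (inner ℂ x x).re = ‖x‖ ^ 2 := inner_self_eq_norm_sq (𝕜 := ℂ) x
    rw [Complex.add_re, h4, Complex.zero_re] at h2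
    have : ‖x‖ ^ 2 = 0 := le_antisymm (by linarith) (sq_nonneg _)
    have hx0 : x = 0 := by simpa using this
    subst hx0
    rw [LinearPMap.graph_fst_eq_zero_snd _ hx rfl, add_zero]
  refine ⟨?_, hp⟩
  rw [LinearPMap.isSelfAdjoint_def]
  apply LinearPMap.eq_of_eq_graph
  ext ⟨x, w⟩
  constructor
  · intro h
    obtain ⟨y, z, hy, e⟩ := h1 (x + w)
    -- `x - y` is in the kernel of `1 + A*`; testing against a preimage of it under `1 + A` gives
    -- `‖x - y‖² = 0`.
    obtain ⟨y', z', hy', e'⟩ := h1 (x - y)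
    have h2 := (mem_graph_adjoint_iff hd).1 h _ _ hy'
    have h3 := hs _ _ _ _ hy hy'
    have hw : w - z = - (x - y) := by
      rw [neg_sub, sub_eq_sub_iff_add_eq_add, add_comm w, ← e]
    have h4 : inner ℂ (x - y) (x - y) = (0 : ℂ) := by
      nth_rw 2 [← e']
      rw [inner_add_right, inner_sub_left (z := z'), ← h2, ← h3, ← inner_sub_left, hw,
        inner_neg_left, add_neg_cancel]
    have h5 : x = y := sub_eq_zero.1 (inner_self_eq_zero.1 h4)
    subst h5
    have : w = z := (add_left_cancel e).symm
    rwa [this]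
  · intro h
    rw [mem_graph_adjoint_iff hd]
    exact fun v z hv => hs _ _ _ _ h hv

/-- Von Neumann's theorem: `T* T` is selfadjoint if `T` is closed and densely defined. -/
theorem isPosSelfAdjoint_adjoint_comp_self [CompleteSpace H] [CompleteSpace K] {T : H →ₗ.[ℂ] K}
    (hT : Dense (T.domain : Set H)) (hc : T.IsClosed) : IsPosSelfAdjoint (opComp T† T) := by
  apply isPosSelfAdjoint_of_surjective
  · intro x w y z hx hy
    obtain ⟨x', hx, hx'⟩ := mem_graph_opComp_iff.1 hx
    obtain ⟨y', hy, hy'⟩ := mem_graph_opComp_iff.1 hy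
    rw [(mem_graph_adjoint_iff hT).1 hx' _ _ hy, ← inner_conj_symm x,
      (mem_graph_adjoint_iff hT).1 hy' _ _ hx, inner_conj_symm]
  · intro x
    obtain ⟨x', hx, hx'⟩ := mem_graph_opComp_iff.1 ((opComp T† T).mem_graph x)
    rw [(mem_graph_adjoint_iff hT).1 hx' _ _ hx]
    exact inner_self_nonneg (𝕜 := ℂ)
  · intro h
    obtain ⟨p, p', q, q', hp, hq, h1, h2⟩ := exists_graph_add_adjoint_graph hT hc h 0
    obtain rfl : p' = q := (sub_eq_zero.1 h2.symm)
    exact ⟨p, q', mem_graph_opComp_iff.2 ⟨_, hp, hq⟩, h1.symm⟩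

/-- The resolvent `R = (1 + A)⁻¹` of a positive, selfadjoint operator. -/
theorem IsPosSelfAdjoint.exists_resolvent [CompleteSpace H] {A : H →ₗ.[ℂ] H}
    (hA : IsPosSelfAdjoint A) :
    ∃ R : H →L[ℂ] H, R.IsPositive ∧ (1 - R).IsPositive ∧
      ∀ x w, (x, w) ∈ A.graph ↔ ∃ f, x = R f ∧ w = f - R f := by
  -- `φ` is `1 + A` on the graph. Positivity makes the cross term of `‖x + w‖²` nonnegative, so `φ`
  -- is bounded below and has closed range.
  let φ : A.graph →L[ℂ] H :=
    (ContinuousLinearMap.fst ℂ H H + ContinuousLinearMap.snd ℂ H H).comp A.graph.subtypeL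
  have hφ : ∀ g : A.graph, φ g = (g : H × H).1 + (g : H × H).2 := fun g => rfl
  have hb : ∀ g : A.graph, ‖g‖ ≤ ‖φ g‖ := by
    rintro ⟨⟨x, w⟩, hg⟩
    have h1 := hA.2.inner_graph hg
    have h2 := norm_add_sq (𝕜 := ℂ) x w
    rw [← inner_conj_symm x w] at h2
    have h3 : RCLike.re ((starRingEnd ℂ) (inner ℂ w x)) = (inner ℂ w x).re := Complex.conj_re _
    rw [h3] at h2
    rw [hφ]
    change max ‖x‖ ‖w‖ ≤ ‖x + w‖
    apply max_le
    · apply le_of_sq_le_sq _ (norm_nonneg _)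
      nlinarith [sq_nonneg ‖w‖]
    · apply le_of_sq_le_sq _ (norm_nonneg _)
      nlinarith [sq_nonneg ‖x‖]
  have hanti : AntilipschitzWith 1 φ :=
    AddMonoidHomClass.antilipschitz_of_bound φ (by simpa using hb)
  have hcl : IsClosed (A.graph : Set (H × H)) := hA.1.isClosed
  have : CompleteSpace A.graph := hcl.completeSpace_coe
  have hclosed : IsClosed (Set.range φ) := hanti.isClosed_range φ.uniformContinuous
  have hsurj : Function.Surjective φ := by
    have htop : LinearMap.range φ.toLinearMap = ⊤ := by
      have hclosed' : IsClosed (LinearMap.range φ.toLinearMap : Set H) := hclosed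
      have : CompleteSpace (LinearMap.range φ.toLinearMap) := hclosed'.completeSpace_coe
      rw [← Submodule.orthogonal_eq_bot_iff, Submodule.eq_bot_iff]
      intro z hz
      -- A vector orthogonal to the range of `1 + A` satisfies `A z = -z`, which positivity allows
      -- only for `z = 0`.
      have hz' : (z, -z) ∈ A.graph := by
        rw [← LinearPMap.isSelfAdjoint_def.1 hA.1, mem_graph_adjoint_iff hA.1.dense_domain]
        intro v w hv
        have := (Submodule.mem_orthogonal' _ _).1 hz _ ⟨⟨(v, w), hv⟩, rfl⟩
        change inner ℂ z (v + w) = 0 at this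
        rw [inner_add_right] at this
        rw [inner_neg_left]
        linear_combination -this
      have h1 := hA.2.inner_graph hz'
      have h4 : (inner ℂ z z).re = ‖z‖ ^ 2 := inner_self_eq_norm_sq (𝕜 := ℂ) z
      rw [inner_neg_left, Complex.neg_re, h4] at h1
      have : ‖z‖ ^ 2 = 0 := le_antisymm (by linarith) (sq_nonneg _)
      simpa using this
    exact LinearMap.range_eq_top.1 htop
  let e : A.graph ≃ₗ[ℂ] H := LinearEquiv.ofBijective φ.toLinearMap ⟨hanti.injective, hsurj⟩
  have he : ∀ f, ((e.symm f : A.graph) : H × H).1 + ((e.symm f : A.graph) : H × H).2 = f :=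
    fun f => e.apply_symm_apply f
  let R : H →L[ℂ] H := LinearMap.mkContinuous
    ((LinearMap.fst ℂ H H ∘ₗ A.graph.subtype) ∘ₗ e.symm.toLinearMap) 1 (by
      intro f
      rw [one_mul]
      refine (norm_fst_le ((e.symm f : A.graph) : H × H)).trans ((hb (e.symm f)).trans ?_)
      rw [hφ, he])
  have hR : ∀ f, R f = ((e.symm f : A.graph) : H × H).1 := fun f => rfl
  have hR2 : ∀ f, ((e.symm f : A.graph) : H × H).2 = f - R f := fun f => by
    rw [hR, eq_sub_iff_add_eq, add_comm, he]
  have hRA : ∀ f, (R f, f - R f) ∈ A.graph := fun f => by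
    rw [← hR2, hR]; exact (e.symm f).2
  have hsym : ∀ f g, inner ℂ (R f) g = inner ℂ f (R g) := fun f g => by
    have := hA.1.inner_graph (hRA f) (hRA g)
    rw [inner_sub_left, inner_sub_right] at this
    linear_combination -this
  have hpos : ∀ f, 0 ≤ (inner ℂ (f - R f) (R f)).re := fun f => hA.2.inner_graph (hRA f)
  have hsq : ∀ f : H, 0 ≤ (inner ℂ f f).re := fun f => inner_self_nonneg (𝕜 := ℂ)
  refine ⟨R, ?_, ?_, ?_⟩
  · refine ⟨hsym, fun f => ?_⟩
    change 0 ≤ (inner ℂ (R f) f).re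
    have h1 := hpos f
    have h2 := hsq (R f)
    rw [inner_sub_left, ← hsym, Complex.sub_re] at h1
    linarith
  · refine ⟨fun f g => ?_, fun f => ?_⟩
    · change inner ℂ (f - R f) g = inner ℂ f (g - R g)
      rw [inner_sub_left, inner_sub_right, hsym]
    · change 0 ≤ (inner ℂ (f - R f) f).re
      have h1 := hpos f
      have h2 := hsq (f - R f)
      rw [inner_sub_right, Complex.sub_re] at h2
      linarith
  · intro x w
    constructor
    · intro h
      refine ⟨x + w, ?_⟩
      have : e.symm (x + w) = ⟨(x, w), h⟩ := by
        rw [LinearEquiv.symm_apply_eq]; rfl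
      rw [hR, this]
      simp
    · rintro ⟨f, rfl, rfl⟩
      exact hRA f

/-- A positive, selfadjoint operator has a positive, selfadjoint square root. -/
theorem IsPosSelfAdjoint.exists_sqrt [CompleteSpace H] {A : H →ₗ.[ℂ] H}
    (hA : IsPosSelfAdjoint A) : ∃ S, IsPosSqrt S A := by
  obtain ⟨R, hR, hR', hgr⟩ := hA.exists_resolvent
  have hR0 : 0 ≤ R := (ContinuousLinearMap.nonneg_iff_isPositive R).2 hR
  have hR1 : 0 ≤ 1 - R := (ContinuousLinearMap.nonneg_iff_isPositive _).2 hR'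
  -- The graph of `A` is `{(R f, (1 - R) f)}`, so the square root should have graph `{(C u, D u)}`,
  -- that is `D C⁻¹`, where `C² = R` and `D² = 1 - R` commute.
  let C := CFC.sqrt R
  let D := CFC.sqrt (1 - R)
  have hC0 : 0 ≤ C := CFC.sqrt_nonneg R
  have hD0 : 0 ≤ D := CFC.sqrt_nonneg (1 - R)
  have hCC : C * C = R := CFC.sqrt_mul_sqrt_self R
  have hDD : D * D = 1 - R := CFC.sqrt_mul_sqrt_self (1 - R)
  have hcomm : Commute C D := by
    have h1 : Commute (1 - R) R := (Commute.one_left R).sub_left (Commute.refl R)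
    have h2 : Commute D R := by
      change Commute (CFC.sqrt (1 - R)) R
      rw [CFC.sqrt_eq_cfc]
      exact h1.cfc_nnreal _
    change Commute (CFC.sqrt R) D
    rw [CFC.sqrt_eq_cfc]
    exact h2.symm.cfc_nnreal _
  have hDC0 : 0 ≤ D * C := hcomm.symm.mul_nonneg hD0 hC0
  have hDCpos := (ContinuousLinearMap.nonneg_iff_isPositive _).1 hDC0
  have hCpos := (ContinuousLinearMap.nonneg_iff_isPositive _).1 hC0
  have hDpos := (ContinuousLinearMap.nonneg_iff_isPositive _).1 hD0
  have cc : ∀ u, C (C u) = R u := fun u => congrArg (fun B : H →L[ℂ] H => B u) hCC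
  have dd : ∀ u, D (D u) = u - R u := fun u => congrArg (fun B : H →L[ℂ] H => B u) hDD
  have cd : ∀ u, C (D u) = D (C u) := fun u => congrArg (fun B : H →L[ℂ] H => B u) hcomm.eq
  have hRinj : ∀ u, R u = 0 → u = 0 := by
    intro u hu
    have := (hgr 0 u).2 ⟨u, hu.symm, by rw [hu, sub_zero]⟩
    exact LinearPMap.graph_fst_eq_zero_snd _ this rfl
  have hCinj : ∀ u, C u = 0 → u = 0 := fun u hu => hRinj u (by rw [← cc, hu, map_zero])
  let G : Submodule ℂ (H × H) := LinearMap.range (C.toLinearMap.prod D.toLinearMap)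
  let S : H →ₗ.[ℂ] H := G.toLinearPMap
  have hS : ∀ x w, (x, w) ∈ S.graph ↔ ∃ u, x = C u ∧ w = D u := by
    intro x w
    have : S.graph = G := by
      apply Submodule.toLinearPMap_graph_eq
      rintro _ ⟨u, rfl⟩ h
      have : u = 0 := hCinj u h
      subst this
      simp
    rw [this]
    simp [G, eq_comm]
  have hSd : Dense (S.domain : Set H) := by
    rw [Submodule.dense_iff_topologicalClosure_eq_top,
      Submodule.topologicalClosure_eq_top_iff, Submodule.eq_bot_iff]
    intro z hz
    apply hCinj
    have := (Submodule.mem_orthogonal' _ _).1 hz (C (C z))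
      (LinearPMap.mem_domain_of_mem_graph ((hS _ _).2 ⟨C z, rfl, rfl⟩))
    rwa [← hCpos.inner_left_eq_inner_right, inner_self_eq_zero] at this
  have hSsa : IsSelfAdjoint S := by
    rw [LinearPMap.isSelfAdjoint_def]
    apply LinearPMap.eq_of_eq_graph
    ext ⟨x, w⟩
    rw [mem_graph_adjoint_iff hSd, hS]
    constructor
    · intro h
      have h1 : C w = D x := by
        refine ext_inner_right ℂ fun u => ?_
        rw [hCpos.inner_left_eq_inner_right, hDpos.inner_left_eq_inner_right]
        exact h _ _ ((hS _ _).2 ⟨u, rfl, rfl⟩)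
      -- From `C² + D² = 1`: if `x = C u` and `w = D u`, then `u = C x + D w`. The same inversion
      -- recovers `f` from `u` and `v` in the composition below.
      refine ⟨C x + D w, ?_, ?_⟩
      · rw [map_add, cc, cd, h1, dd]; abel
      · rw [map_add, dd, ← cd, ← h1, cc]; abel
    · rintro ⟨u, rfl, rfl⟩ v z hv
      obtain ⟨v, rfl, rfl⟩ := (hS _ _).1 hv
      rw [hDpos.inner_left_eq_inner_right, hCpos.inner_left_eq_inner_right, cd]
  refine ⟨S, ⟨hSsa, fun x => ?_⟩, ?_⟩
  · obtain ⟨u, hu, hu'⟩ := (hS _ _).1 (S.mem_graph x)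
    rw [hu, hu', ← hCpos.inner_left_eq_inner_right, cd]
    exact hDCpos.re_inner_nonneg_left u
  · apply LinearPMap.eq_of_eq_graph
    ext ⟨x, w⟩
    rw [mem_graph_opComp_iff, hgr]
    constructor
    · rintro ⟨y, h1, h2⟩
      obtain ⟨u, rfl, rfl⟩ := (hS _ _).1 h1
      obtain ⟨v, h3, rfl⟩ := (hS _ _).1 h2
      have hu : C (C u + D v) = u := by rw [map_add, cc, cd, ← h3, dd]; abel
      have hv : D (C u + D v) = v := by rw [map_add, dd, ← cd, h3, cc]; abel
      refine ⟨C u + D v, ?_, ?_⟩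
      · rw [← cc, hu]
      · rw [← dd, hv]
    · rintro ⟨f, rfl, rfl⟩
      exact ⟨D (C f), (hS _ _).2 ⟨C f, (cc f).symm, rfl⟩,
        (hS _ _).2 ⟨D f, (cd f).symm, (dd f).symm⟩⟩

end Graph

/-! ### The quadratic form of an operator. -/

section Form

variable {H K L : Type*} [NormedAddCommGroup H] [InnerProductSpace ℂ H]
  [NormedAddCommGroup K] [InnerProductSpace ℂ K] [NormedAddCommGroup L] [InnerProductSpace ℂ L]

theorem isPosSqrt_posSqrt [CompleteSpace H] {A : H →ₗ.[ℂ] H} (hA : IsPosSelfAdjoint A) :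
    IsPosSqrt (posSqrt A) A := by
  have h := hA.exists_sqrt
  rw [posSqrt, dif_pos h]
  exact h.choose_spec

/-- `m` bounds the form of `A` at `x`; the form domain of `A` consists of the `x` with a bound. -/
def IsFormBound (A : H →ₗ.[ℂ] H) (x : H) (m : ℝ) : Prop :=
  ∀ y : A.domain, ‖inner ℂ (A y) x‖ ^ 2 ≤ m * (inner ℂ (A y) (y : H)).re

theorem IsFormBound.mono {A : H →ₗ.[ℂ] H} (hA : OpNonneg A) {x : H} {m n : ℝ}
    (h : IsFormBound A x m) (hmn : m ≤ n) : IsFormBound A x n :=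
  fun y => (h y).trans (mul_le_mul_of_nonneg_right hmn (hA y))

/-- A smaller operator has fewer test vectors. This monotonicity is the source of the minimality of
`a_K`. -/
theorem IsFormBound.of_le {A B : H →ₗ.[ℂ] H} (hAB : A ≤ B) {x : H} {m : ℝ}
    (h : IsFormBound B x m) : IsFormBound A x m := by
  intro y
  have h1 : A y = B ⟨y, hAB.1 y.2⟩ := hAB.2 rfl
  rw [h1]
  exact h ⟨y, hAB.1 y.2⟩

/-- `x ↦ ‖T x‖²`, with domain `dom T`, is the form of `A`. -/
def FormRepresents (T : H →ₗ.[ℂ] K) (A : H →ₗ.[ℂ] H) : Prop :=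
  ∀ x m, 0 ≤ m → (IsFormBound A x m ↔ ∃ hx : x ∈ T.domain, ‖T ⟨x, hx⟩‖ ^ 2 ≤ m)

namespace FormRepresents

variable {T : H →ₗ.[ℂ] K} {T' : H →ₗ.[ℂ] L} {A B : H →ₗ.[ℂ] H}

theorem isFormBound (h : FormRepresents T A) (x : T.domain) : IsFormBound A x (‖T x‖ ^ 2) :=
  (h x _ (sq_nonneg _)).2 ⟨x.2, le_rfl⟩

theorem exists_norm_le (h : FormRepresents T A) (h' : FormRepresents T' B)
    (hle : ∀ x m, IsFormBound B x m → IsFormBound A x m) (x : H) (hx : x ∈ T'.domain) :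
    ∃ hx' : x ∈ T.domain, ‖T ⟨x, hx'⟩‖ ≤ ‖T' ⟨x, hx⟩‖ := by
  obtain ⟨hx', hn⟩ := (h x _ (sq_nonneg _)).1 (hle _ _ (h'.isFormBound ⟨x, hx⟩))
  exact ⟨hx', le_of_sq_le_sq hn (norm_nonneg _)⟩

theorem domain_eq (h : FormRepresents T A) (h' : FormRepresents T' A) : T.domain = T'.domain := by
  ext x
  exact ⟨fun hx => (h'.exists_norm_le h (fun _ _ => id) x hx).1,
    fun hx => (h.exists_norm_le h' (fun _ _ => id) x hx).1⟩

theorem norm_eq (h : FormRepresents T A) (h' : FormRepresents T' A) (x : H) (hx : x ∈ T.domain)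
    (hx' : x ∈ T'.domain) : ‖T ⟨x, hx⟩‖ = ‖T' ⟨x, hx'⟩‖ :=
  le_antisymm (h.exists_norm_le h' (fun _ _ => id) x hx').2
    (h'.exists_norm_le h (fun _ _ => id) x hx).2

end FormRepresents

theorem FormRepresents.fdom_eq {T : H →ₗ.[ℂ] K} {a : PosSymOp H} (h : FormRepresents T a.op) :
    a.fdom = T.domain := by
  ext x
  constructor
  · rintro ⟨m, hm⟩
    -- A bound may be negative where the form of `a` vanishes identically, while `FormRepresents`
    -- speaks only of `m ≥ 0`.
    exact ((h x (max m 0) (le_max_right _ _)).1 (IsFormBound.mono a.nonneg hm (le_max_left _ _))).1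
  · intro hx
    exact ⟨_, h.isFormBound ⟨x, hx⟩⟩

/-- Polarization, for maps whose target spaces may differ. -/
theorem inner_map_map_eq_of_norm_eq {V : Type*} [AddCommGroup V] [Module ℂ V]
    {f : V →ₗ[ℂ] K} {g : V →ₗ[ℂ] L} (h : ∀ v, ‖f v‖ = ‖g v‖) (u v : V) :
    inner ℂ (f u) (f v) = inner ℂ (g u) (g v) := by
  rw [inner_eq_sum_norm_sq_div_four, inner_eq_sum_norm_sq_div_four]
  simp only [← map_add, ← map_sub, ← map_smul, h]

/-- `T* T` depends only on the form `x ↦ ‖T x‖²`. -/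
theorem adjoint_comp_self_congr [CompleteSpace H] {T : H →ₗ.[ℂ] K} {T' : H →ₗ.[ℂ] L}
    (hT : Dense (T.domain : Set H)) (hd : T.domain = T'.domain)
    (hn : ∀ x (hx : x ∈ T.domain) (hx' : x ∈ T'.domain), ‖T ⟨x, hx⟩‖ = ‖T' ⟨x, hx'⟩‖) :
    opComp T† T = opComp T'† T' := by
  obtain ⟨D, f⟩ := T
  obtain ⟨D', g⟩ := T'
  change D = D' at hd
  subst hd
  have hT' : Dense ((LinearPMap.mk D g).domain : Set H) := hT
  have hin := inner_map_map_eq_of_norm_eq (f := f) (g := g) fun v => hn v v.2 v.2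
  apply LinearPMap.eq_of_eq_graph
  ext ⟨x, z⟩
  simp only [mem_graph_opComp_iff, LinearPMap.mem_graph_iff (LinearPMap.mk D f),
    LinearPMap.mem_graph_iff (LinearPMap.mk D g)]
  constructor
  · rintro ⟨y, ⟨x, rfl, rfl⟩, h⟩
    refine ⟨g x, ⟨x, rfl, rfl⟩, (mem_graph_adjoint_iff hT').2 fun v w hv => ?_⟩
    obtain ⟨v, rfl, rfl⟩ := (LinearPMap.mem_graph_iff _).1 hv
    exact ((mem_graph_adjoint_iff hT).1 h _ _ (LinearPMap.mem_graph ⟨D, f⟩ v)).trans (hin x v)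
  · rintro ⟨y, ⟨x, rfl, rfl⟩, h⟩
    refine ⟨f x, ⟨x, rfl, rfl⟩, (mem_graph_adjoint_iff hT).2 fun v w hv => ?_⟩
    obtain ⟨v, rfl, rfl⟩ := (LinearPMap.mem_graph_iff _).1 hv
    exact ((mem_graph_adjoint_iff hT').1 h _ _ (LinearPMap.mem_graph ⟨D, g⟩ v)).trans (hin x v).symm

/-- A functional dominated by a linear map into a Hilbert space factors through it. -/
theorem exists_inner_eq_of_norm_le [CompleteSpace K] {V : Type*} [AddCommGroup V] [Module ℂ V]
    (f : V →ₗ[ℂ] K) (g : V →ₗ[ℂ] ℂ) {c : ℝ} (hc : 0 ≤ c) (h : ∀ v, ‖g v‖ ≤ c * ‖f v‖) :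
    ∃ k, ‖k‖ ≤ c ∧ ∀ v, inner ℂ k (f v) = g v := by
  have hker : LinearMap.ker f ≤ LinearMap.ker g := fun v hv => by
    have := h v
    rw [LinearMap.mem_ker.1 hv, norm_zero, mul_zero] at this
    exact norm_le_zero_iff.1 this
  let l : LinearMap.range f →ₗ[ℂ] ℂ :=
    (LinearMap.ker f).liftQ g hker ∘ₗ f.quotKerEquivRange.symm.toLinearMap
  have hl : ∀ v, l ⟨f v, v, rfl⟩ = g v := fun v => by
    have : f.quotKerEquivRange.symm ⟨f v, v, rfl⟩ = (LinearMap.ker f).mkQ v := by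
      rw [LinearEquiv.symm_apply_eq]
      rfl
    change (LinearMap.ker f).liftQ g hker (f.quotKerEquivRange.symm ⟨f v, v, rfl⟩) = _
    rw [this]
    rfl
  let l' : StrongDual ℂ (LinearMap.range f) := l.mkContinuous c (by
    rintro ⟨_, v, rfl⟩
    rw [hl]
    exact h v)
  -- Hahn–Banach then Riesz: the range of `f` need be neither closed nor dense.
  obtain ⟨e, he, hn⟩ := exists_extension_norm_eq _ l'
  refine ⟨(InnerProductSpace.toDual ℂ K).symm e, ?_, fun v => ?_⟩
  · rw [LinearIsometryEquiv.norm_map, hn]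
    exact LinearMap.mkContinuous_norm_le _ hc _
  · rw [InnerProductSpace.toDual_symm_apply]
    exact (he ⟨f v, v, rfl⟩).trans (hl v)

/-- If `T` is closed and densely defined then `x ↦ ‖T x‖²` is the form of `T* T`. -/
theorem formRepresents_adjoint_comp_self [CompleteSpace H] [CompleteSpace K] {T : H →ₗ.[ℂ] K}
    (hT : Dense (T.domain : Set H)) (hc : T.IsClosed) : FormRepresents T (opComp T† T) := by
  intro x m hm
  constructor
  · intro h
    let A := opComp T† T
    have hdom : A.domain ≤ T.domain := fun y hy => (mem_opComp_domain.1 hy).1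
    let f : A.domain →ₗ[ℂ] K := T.toFun ∘ₗ Submodule.inclusion hdom
    have hf : ∀ y : A.domain, (f y, A y) ∈ T†.graph := by
      rintro ⟨y, hy⟩
      obtain ⟨h1, h2⟩ := mem_opComp_domain.1 hy
      exact T†.mem_graph ⟨_, h2⟩
    have hfT : ∀ y : A.domain, ((y : H), f y) ∈ T.graph := fun y => T.mem_graph ⟨y, hdom y.2⟩
    have hAf : ∀ y : A.domain, (inner ℂ (A y) (y : H)).re = ‖f y‖ ^ 2 := fun y => by
      rw [(mem_graph_adjoint_iff hT).1 (hf y) _ _ (hfT y)]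
      exact inner_self_eq_norm_sq (𝕜 := ℂ) _
    -- Since `(A y, y) = ‖T y‖²`, the bound makes `y ↦ (x, A y)` a functional of `T y` of norm at
    -- most `√m`. Its representative `k` is `T x` up to a vector in the kernel of `T*`.
    obtain ⟨k, hk, hkf⟩ := exists_inner_eq_of_norm_le f (innerₛₗ ℂ x ∘ₗ A.toFun)
      (Real.sqrt_nonneg m) fun y => by
        have := h y
        rw [hAf] at this
        apply le_of_sq_le_sq _ (by positivity)
        rw [mul_pow, Real.sq_sqrt hm]
        refine le_trans (le_of_eq ?_) this
        rw [norm_inner_symm]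
        rfl
    replace hkf : ∀ y : A.domain, inner ℂ k (f y) = inner ℂ x (A y) := hkf
    obtain ⟨p, p', q, q', hp, hq, rfl, rfl⟩ := exists_graph_add_adjoint_graph hT hc x k
    -- Writing `q' = y + A y`, the identity for `k` at this `y` reduces to `(q', y + A y) = 0`.
    have h0 : q' = 0 := by
      obtain ⟨y, y', r, r', hy, hr, e1, e2⟩ := exists_graph_add_adjoint_graph hT hc q' 0
      obtain rfl : y' = r := sub_eq_zero.1 e2.symm
      have hyA : (y, r') ∈ A.graph := mem_graph_opComp_iff.2 ⟨_, hy, hr⟩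
      obtain ⟨y, rfl, rfl⟩ := (LinearPMap.mem_graph_iff _).1 hyA
      obtain rfl : y' = f y := LinearPMap.mem_graph_snd_inj _ hy (hfT y) rfl
      have h1 := hkf y
      have h2 := (mem_graph_adjoint_iff hT).1 (hf y) _ _ hp
      rw [← inner_conj_symm, ← inner_conj_symm (f y)] at h2
      have h2' := (starRingEnd ℂ).injective h2
      have h3 := (mem_graph_adjoint_iff hT).1 hq _ _ hy
      rw [inner_sub_left, inner_add_left, ← h3, h2'] at h1
      have h4 : inner ℂ q' ((y : H) + A y) = (0 : ℂ) := by
        rw [inner_add_right]; linear_combination -h1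
      rw [← e1] at h4
      exact inner_self_eq_zero.1 h4
    subst h0
    obtain ⟨p, rfl, rfl⟩ := (LinearPMap.mem_graph_iff _).1 hp
    rw [add_zero]
    refine ⟨p.2, ?_⟩
    -- Now `T* q = 0`, so `q` is orthogonal to `T p` and `‖T p‖² + ‖q‖² = ‖k‖² ≤ m`.
    have h5 := (mem_graph_adjoint_iff hT).1 hq _ _ hp
    rw [inner_zero_left] at h5
    have h6 := norm_sub_sq (𝕜 := ℂ) (T p) q
    rw [← inner_conj_symm, ← h5, map_zero, map_zero] at h6
    have h7 := pow_le_pow_left₀ (norm_nonneg _) hk 2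
    rw [Real.sq_sqrt hm, h6] at h7
    nlinarith [sq_nonneg ‖q‖]
  · rintro ⟨hx, hn⟩ ⟨y, hy⟩
    obtain ⟨h1, h2⟩ := mem_opComp_domain.1 hy
    have hg : (T ⟨y, h1⟩, opComp T† T ⟨y, hy⟩) ∈ T†.graph := T†.mem_graph ⟨_, h2⟩
    have h3 := (mem_graph_adjoint_iff hT).1 hg
    rw [h3 _ _ (T.mem_graph ⟨x, hx⟩), h3 _ _ (T.mem_graph ⟨y, h1⟩)]
    have h4 : (inner ℂ (T ⟨y, h1⟩) (T ⟨y, h1⟩)).re = ‖T ⟨y, h1⟩‖ ^ 2 :=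
      inner_self_eq_norm_sq (𝕜 := ℂ) _
    rw [h4]
    calc ‖inner ℂ (T ⟨y, h1⟩) (T ⟨x, hx⟩)‖ ^ 2
        ≤ (‖T ⟨y, h1⟩‖ * ‖T ⟨x, hx⟩‖) ^ 2 :=
          pow_le_pow_left₀ (norm_nonneg _) (norm_inner_le_norm _ _) 2
      _ = ‖T ⟨x, hx⟩‖ ^ 2 * ‖T ⟨y, h1⟩‖ ^ 2 := by ring
      _ ≤ m * ‖T ⟨y, h1⟩‖ ^ 2 := by gcongr

/-- The square root `S` is selfadjoint, so `A = S S = S* S`. -/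
theorem formRepresents_posSqrt [CompleteSpace H] {A : H →ₗ.[ℂ] H} (hA : IsPosSelfAdjoint A) :
    FormRepresents (posSqrt A) A := by
  obtain ⟨⟨h1, -⟩, h2⟩ := isPosSqrt_posSqrt hA
  have h := formRepresents_adjoint_comp_self h1.dense_domain h1.isClosed
  rwa [LinearPMap.isSelfAdjoint_def.1 h1, h2] at h

/-- The form order on positive, selfadjoint operators is antisymmetric. -/
theorem FormLE.antisymm [CompleteSpace H] {A B : H →ₗ.[ℂ] H} (hA : IsPosSelfAdjoint A)
    (hB : IsPosSelfAdjoint B) (hAB : FormLE A B) (hBA : FormLE B A) : A = B := by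
  obtain ⟨⟨h1, -⟩, h2⟩ := isPosSqrt_posSqrt hA
  obtain ⟨⟨h3, -⟩, h4⟩ := isPosSqrt_posSqrt hB
  have := adjoint_comp_self_congr (T := posSqrt A) (T' := posSqrt B) h1.dense_domain
    (Submodule.ext fun x => ⟨fun hx => (hBA x hx).1, fun hx => (hAB x hx).1⟩)
    (fun x hx hx' => le_antisymm (hAB x hx').2 (hBA x hx).2)
  rwa [LinearPMap.isSelfAdjoint_def.1 h1, LinearPMap.isSelfAdjoint_def.1 h3, h2, h4] at this

end Form

/-! ### The adjoints `J_a*` and `J*`. -/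

namespace PosSymOp

variable {H : Type*} [NormedAddCommGroup H] [InnerProductSpace ℂ H]

theorem ranToHil_denseRange (a : PosSymOp H) : DenseRange a.ranToHil :=
  UniformSpace.Completion.denseRange_coe

theorem norm_ranToHil_toRan_sq (a : PosSymOp H) (x : a.op.domain) :
    ‖a.ranToHil (a.toRan x)‖ ^ 2 = (inner ℂ (a.op x) (x : H)).re := by
  rw [← inner_toRan]
  change ‖((a.toRan x : a.Ran) : a.Hil)‖ ^ 2 = _
  rw [UniformSpace.Completion.norm_coe]
  exact (inner_self_eq_norm_sq (𝕜 := ℂ) _).symm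

theorem dense_J₁_domain (a : PosSymOp H) (ha : Dense a.fdom) :
    Dense (a.J₁.domain : Set a.Hil) := by
  refine a.ranToHil_denseRange.mono ?_
  rintro _ ⟨u, rfl⟩
  exact LinearPMap.mem_domain_of_mem_graph ((a.J₁_graph ha _ _).2 ⟨u, rfl, rfl⟩)

theorem mem_graph_J₁_adjoint_iff (a : PosSymOp H) (ha : Dense a.fdom) {x : H} {p : a.Hil} :
    (x, p) ∈ a.J₁†.graph ↔ ∀ u, inner ℂ p (a.ranToHil u) = inner ℂ x (a.ranIncl u) := by
  rw [mem_graph_adjoint_iff (a.dense_J₁_domain ha)]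
  constructor
  · exact fun h u => h _ _ ((a.J₁_graph ha _ _).2 ⟨u, rfl, rfl⟩)
  · intro h v z hv
    obtain ⟨u, rfl, rfl⟩ := (a.J₁_graph ha _ _).1 hv
    exact h u

theorem exists_toRan_eq (a : PosSymOp H) (u : a.Ran) : ∃ x, a.toRan x = u :=
  ⟨a.preimg u, Subtype.ext (a.op_preimg u)⟩

/-- `x ↦ ‖J_a* x‖²` is the form of `a`. -/
theorem formRepresents_J₁_adjoint (a : PosSymOp H) (ha : Dense a.fdom) :
    FormRepresents a.J₁† a.op := by
  intro x m hm
  constructor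
  · intro h
    -- The bound says that `u ↦ (x, u)` on `ran a` has norm at most `√m` for the norm of `H_a`; its
    -- representative is `J_a* x`.
    obtain ⟨p, hp, hpu⟩ := exists_inner_eq_of_norm_le a.ranToHil (innerₛₗ ℂ x ∘ₗ a.ranIncl)
      (Real.sqrt_nonneg m) fun u => by
        obtain ⟨y, rfl⟩ := a.exists_toRan_eq u
        have := h y
        rw [← norm_ranToHil_toRan_sq, norm_inner_symm] at this
        apply le_of_sq_le_sq _ (by positivity)
        rw [mul_pow, Real.sq_sqrt hm]
        exact this
    obtain ⟨x, rfl, rfl⟩ := (LinearPMap.mem_graph_iff _).1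
      ((a.mem_graph_J₁_adjoint_iff ha (x := x) (p := p)).2 hpu)
    refine ⟨x.2, ?_⟩
    have := pow_le_pow_left₀ (norm_nonneg _) hp 2
    rwa [Real.sq_sqrt hm] at this
  · rintro ⟨hx, hn⟩ y
    have h1 : inner ℂ (a.J₁† ⟨x, hx⟩) (a.ranToHil (a.toRan y)) = inner ℂ x (a.op y) :=
      (a.mem_graph_J₁_adjoint_iff ha).1 (a.J₁†.mem_graph ⟨x, hx⟩) (a.toRan y)
    rw [← norm_ranToHil_toRan_sq, norm_inner_symm, ← h1]
    calc _ ≤ (‖a.J₁† ⟨x, hx⟩‖ * ‖a.ranToHil (a.toRan y)‖) ^ 2 :=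
          pow_le_pow_left₀ (norm_nonneg _) (norm_inner_le_norm _ _) 2
      _ = ‖a.J₁† ⟨x, hx⟩‖ ^ 2 * ‖a.ranToHil (a.toRan y)‖ ^ 2 := by ring
      _ ≤ m * ‖a.ranToHil (a.toRan y)‖ ^ 2 := by gcongr

theorem dense_J₁_adjoint_domain (a : PosSymOp H) (ha : Dense a.fdom) :
    Dense (a.J₁†.domain : Set H) := by
  rw [← (a.formRepresents_J₁_adjoint ha).fdom_eq]
  exact ha

theorem dense_J₂_domain {a b : PosSymOp H} (ha : Dense a.fdom) (hb : Dense b.fdom) :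
    Dense ((J₂ a b).domain : Set (WithLp 2 (a.Hil × b.Hil))) := by
  have h1 : DenseRange (WithLp.toLp 2 ∘ Prod.map a.ranToHil b.ranToHil) :=
    ((WithLp.linearEquiv 2 ℂ (a.Hil × b.Hil)).symm.surjective.denseRange).comp
      (a.ranToHil_denseRange.prodMap b.ranToHil_denseRange)
      (WithLp.prod_continuous_toLp 2 a.Hil b.Hil)
  refine h1.mono ?_
  rintro _ ⟨⟨u, v⟩, rfl⟩
  exact LinearPMap.mem_domain_of_mem_graph
    ((J₂_graph a b ha hb _ _ _).2 ⟨u, v, rfl, rfl, rfl⟩)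

/-- `dom J` is the full sum `ran a ⊕ ran b`, so the two components can be tested separately. This
makes the form of `a ∔ b` a sum. -/
theorem mem_graph_J₂_adjoint_iff {a b : PosSymOp H} (ha : Dense a.fdom) (hb : Dense b.fdom)
    {x : H} {r : WithLp 2 (a.Hil × b.Hil)} :
    (x, r) ∈ (J₂ a b)†.graph ↔ (x, r.fst) ∈ a.J₁†.graph ∧ (x, r.snd) ∈ b.J₁†.graph := by
  rw [mem_graph_adjoint_iff (dense_J₂_domain ha hb), a.mem_graph_J₁_adjoint_iff ha,
    b.mem_graph_J₁_adjoint_iff hb]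
  constructor
  · intro h
    have h' : ∀ u v, inner ℂ r.fst (a.ranToHil u) + inner ℂ r.snd (b.ranToHil v) =
        inner ℂ x (a.ranIncl u + b.ranIncl v) := fun u v =>
      h (WithLp.toLp 2 (a.ranToHil u, b.ranToHil v)) _
        ((J₂_graph a b ha hb _ _ _).2 ⟨u, v, rfl, rfl, rfl⟩)
    exact ⟨fun u => by simpa using h' u 0, fun v => by simpa using h' 0 v⟩
  · rintro ⟨h1, h2⟩ ⟨s, t⟩ z hv
    obtain ⟨u, v, rfl, rfl, rfl⟩ := (J₂_graph a b ha hb _ _ _).1 hv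
    rw [inner_add_right, ← h1, ← h2, WithLp.prod_inner_apply]
    rfl

theorem mem_J₂_adjoint_domain_iff {a b : PosSymOp H} (ha : Dense a.fdom) (hb : Dense b.fdom)
    {x : H} :
    x ∈ (J₂ a b)†.domain ↔ x ∈ a.J₁†.domain ∧ x ∈ b.J₁†.domain := by
  simp only [LinearPMap.mem_domain_iff]
  constructor
  · rintro ⟨r, hr⟩
    obtain ⟨h1, h2⟩ := (mem_graph_J₂_adjoint_iff ha hb).1 hr
    exact ⟨⟨_, h1⟩, ⟨_, h2⟩⟩
  · rintro ⟨⟨p, hp⟩, ⟨q, hq⟩⟩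
    exact ⟨WithLp.toLp 2 (p, q), (mem_graph_J₂_adjoint_iff ha hb).2 ⟨hp, hq⟩⟩

theorem norm_J₂_adjoint_sq {a b : PosSymOp H} (ha : Dense a.fdom) (hb : Dense b.fdom) (x : H)
    (hx : x ∈ (J₂ a b)†.domain) (hxa : x ∈ a.J₁†.domain) (hxb : x ∈ b.J₁†.domain) :
    ‖(J₂ a b)† ⟨x, hx⟩‖ ^ 2 = ‖a.J₁† ⟨x, hxa⟩‖ ^ 2 + ‖b.J₁† ⟨x, hxb⟩‖ ^ 2 := by
  obtain ⟨h1, h2⟩ := (mem_graph_J₂_adjoint_iff ha hb).1 ((J₂ a b)†.mem_graph ⟨x, hx⟩)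
  rw [WithLp.prod_norm_sq_eq_of_L2,
    LinearPMap.mem_graph_snd_inj _ h1 (a.J₁†.mem_graph ⟨x, hxa⟩) rfl,
    LinearPMap.mem_graph_snd_inj _ h2 (b.J₁†.mem_graph ⟨x, hxb⟩) rfl]

theorem dense_J₂_adjoint_domain {a b : PosSymOp H} (hd : Dense (a.fdom ∩ b.fdom)) :
    Dense ((J₂ a b)†.domain : Set H) := by
  have ha := hd.mono Set.inter_subset_left
  have hb := hd.mono Set.inter_subset_right
  refine hd.mono fun x hx => ?_
  rw [(a.formRepresents_J₁_adjoint ha).fdom_eq, (b.formRepresents_J₁_adjoint hb).fdom_eq] at hx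
  exact (mem_J₂_adjoint_domain_iff ha hb).2 hx

/-! ### The Krein–von Neumann extension and the form sum. -/

variable [CompleteSpace H]

theorem formRepresents_J₁_adjoint_krein (a : PosSymOp H) (ha : Dense a.fdom) :
    FormRepresents a.J₁† a.krein.op :=
  formRepresents_adjoint_comp_self (a.dense_J₁_adjoint_domain ha)
    (LinearPMap.adjoint_isClosed (a.dense_J₁_domain ha))

theorem fdom_krein (a : PosSymOp H) (ha : Dense a.fdom) : a.krein.fdom = a.fdom :=
  (a.formRepresents_J₁_adjoint_krein ha).fdom_eq.trans
    (a.formRepresents_J₁_adjoint ha).fdom_eq.symm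

theorem isPosSelfAdjoint_krein (a : PosSymOp H) (ha : Dense a.fdom) :
    IsPosSelfAdjoint a.krein.op :=
  isPosSelfAdjoint_adjoint_comp_self (a.dense_J₁_adjoint_domain ha)
    (LinearPMap.adjoint_isClosed (a.dense_J₁_domain ha))

/-- Symmetry of `a` gives `J_a* x = a x`, viewed in `H_a`, for `x` in `dom a`; and `J_a**` extends
`J_a`, which sends this vector to `a x` in `H`. -/
theorem op_le_krein (a : PosSymOp H) (ha : Dense a.fdom) : a.op ≤ a.krein.op := by
  apply LinearPMap.le_of_le_graph
  rintro ⟨x, z⟩ h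
  obtain ⟨x, rfl, rfl⟩ := (LinearPMap.mem_graph_iff _).1 h
  refine mem_graph_opComp_iff.2 ⟨a.ranToHil (a.toRan x), ?_, ?_⟩
  · rw [a.mem_graph_J₁_adjoint_iff ha]
    intro u
    obtain ⟨y, rfl⟩ := a.exists_toRan_eq u
    refine (UniformSpace.Completion.inner_coe (𝕜 := ℂ) (a.toRan x) (a.toRan y)).trans ?_
    rw [inner_toRan, a.symmetric]
    rfl
  · rw [mem_graph_adjoint_iff (a.dense_J₁_adjoint_domain ha)]
    intro v p hv
    have := (a.mem_graph_J₁_adjoint_iff ha).1 hv (a.toRan x)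
    rw [← inner_conj_symm, ← inner_conj_symm (a.ranToHil (a.toRan x)), this]
    rfl

/-- The form of `B` dominates that of `a`, which is already the form of `a_K`. -/
theorem formLE_krein (a : PosSymOp H) (ha : Dense a.fdom) {B : H →ₗ.[ℂ] H}
    (hB : IsPosSelfAdjoint B) (haB : a.op ≤ B) : FormLE a.krein.op B := by
  have h1 := formRepresents_posSqrt (a.isPosSelfAdjoint_krein ha)
  have h2 := formRepresents_posSqrt hB
  have h3 := a.formRepresents_J₁_adjoint ha
  have h4 := a.formRepresents_J₁_adjoint_krein ha
  intro x hx
  obtain ⟨hx', hn⟩ := h3.exists_norm_le h2 (fun _ _ => IsFormBound.of_le haB) x hx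
  obtain ⟨hx'', hn'⟩ := h1.exists_norm_le h4 (fun _ _ => id) x hx'
  exact ⟨hx'', hn'.trans hn⟩

/-- `a_K` is the unique Krein-von Neumann extension of `a`. -/
theorem isKreinVonNeumann_iff (a : PosSymOp H) (ha : Dense a.fdom) (A : H →ₗ.[ℂ] H) :
    IsKreinVonNeumann a.op A ↔ A = a.krein.op := by
  constructor
  · rintro ⟨⟨h1, h2⟩, h3⟩
    exact FormLE.antisymm h1 (a.isPosSelfAdjoint_krein ha)
      (h3 _ (a.isPosSelfAdjoint_krein ha) (a.op_le_krein ha)) (a.formLE_krein ha h1 h2)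
  · rintro rfl
    exact ⟨⟨a.isPosSelfAdjoint_krein ha, a.op_le_krein ha⟩, fun B => a.formLE_krein ha⟩

variable {a b : PosSymOp H}

/-- The two operators `J` start from different Hilbert spaces, so only the domains and norms of
their adjoints are compared. -/
theorem formSum_eq_formSum_krein (hd : Dense (a.fdom ∩ b.fdom)) :
    a.formSum b = a.krein.formSum b.krein := by
  have ha : Dense a.fdom := hd.mono Set.inter_subset_left
  have hb : Dense b.fdom := hd.mono Set.inter_subset_right
  have ha' : Dense a.krein.fdom := by rwa [a.fdom_krein ha]
  have hb' : Dense b.krein.fdom := by rwa [b.fdom_krein hb]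
  have a1 := a.formRepresents_J₁_adjoint_krein ha
  have b1 := b.formRepresents_J₁_adjoint_krein hb
  have a2 := a.krein.formRepresents_J₁_adjoint ha'
  have b2 := b.krein.formRepresents_J₁_adjoint hb'
  have ea := a1.domain_eq a2
  have eb := b1.domain_eq b2
  refine PosSymOp.ext (adjoint_comp_self_congr (dense_J₂_adjoint_domain hd) ?_ ?_)
  · ext x
    rw [mem_J₂_adjoint_domain_iff ha hb, mem_J₂_adjoint_domain_iff ha' hb', ea, eb]
  · intro x hx hx'
    obtain ⟨h1, h2⟩ := (mem_J₂_adjoint_domain_iff ha hb).1 hx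
    obtain ⟨h3, h4⟩ := (mem_J₂_adjoint_domain_iff ha' hb').1 hx'
    rw [← sq_eq_sq₀ (norm_nonneg _) (norm_nonneg _), norm_J₂_adjoint_sq ha hb x hx h1 h2,
      norm_J₂_adjoint_sq ha' hb' x hx' h3 h4, a1.norm_eq a2, b1.norm_eq b2]

theorem isClassicalFormSum_krein (hd : Dense (a.fdom ∩ b.fdom)) :
    IsClassicalFormSum a.krein.op b.krein.op (a.formSum b).op := by
  have ha : Dense a.fdom := hd.mono Set.inter_subset_left
  have hb : Dense b.fdom := hd.mono Set.inter_subset_right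
  have hdense := dense_J₂_adjoint_domain hd
  have hclosed := LinearPMap.adjoint_isClosed (dense_J₂_domain ha hb)
  have hC : IsPosSelfAdjoint (a.formSum b).op :=
    isPosSelfAdjoint_adjoint_comp_self hdense hclosed
  have c1 := formRepresents_posSqrt hC
  have c2 : FormRepresents (J₂ a b)† (a.formSum b).op :=
    formRepresents_adjoint_comp_self hdense hclosed
  have a1 := formRepresents_posSqrt (a.isPosSelfAdjoint_krein ha)
  have a2 := a.formRepresents_J₁_adjoint_krein ha
  have b1 := formRepresents_posSqrt (b.isPosSelfAdjoint_krein hb)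
  have b2 := b.formRepresents_J₁_adjoint_krein hb
  refine ⟨hC, ?_, ?_⟩
  · ext x
    rw [c1.domain_eq c2, a1.domain_eq a2, b1.domain_eq b2, Submodule.mem_inf,
      mem_J₂_adjoint_domain_iff ha hb]
  · intro x hxC hxA hxB
    have hxC' := hxC
    have hxA' := hxA
    have hxB' := hxB
    rw [c1.domain_eq c2] at hxC'
    rw [a1.domain_eq a2] at hxA'
    rw [b1.domain_eq b2] at hxB'
    rw [c1.norm_eq c2 x hxC hxC', a1.norm_eq a2 x hxA hxA', b1.norm_eq b2 x hxB hxB']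
    exact norm_J₂_adjoint_sq ha hb x hxC' hxA' hxB'

end PosSymOp

theorem theorem4 {H : Type*} [NormedAddCommGroup H] [InnerProductSpace ℂ H] [CompleteSpace H]
    (a b : PosSymOp H) (hd : Dense (a.fdom ∩ b.fdom)) :
    (∀ A : H →ₗ.[ℂ] H, IsKreinVonNeumann a.op A ↔ A = a.krein.op) ∧
    (∀ B : H →ₗ.[ℂ] H, IsKreinVonNeumann b.op B ↔ B = b.krein.op) ∧
    Dense (a.krein.fdom ∩ b.krein.fdom) ∧
    a.formSum b = a.krein.formSum b.krein ∧
    IsClassicalFormSum a.krein.op b.krein.op (a.formSum b).op := by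
  have ha : Dense a.fdom := hd.mono Set.inter_subset_left
  have hb : Dense b.fdom := hd.mono Set.inter_subset_right
  refine ⟨a.isKreinVonNeumann_iff ha, b.isKreinVonNeumann_iff hb, ?_,
    PosSymOp.formSum_eq_formSum_krein hd, PosSymOp.isClassicalFormSum_krein hd⟩
  rwa [a.fdom_krein ha, b.fdom_krein hb]
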